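/- **Theorem.** For every cardinal $\kappa$ there is a hereditarily indecomposable compact Hausdorff space $X$ of weight $\kappa$ such that every nontrivial (that is, having more than one point) subcontinuum of $X$ has an essential family of cardinality $\kappa$. If $\kappa$ is infinite, then $X$ can moreover be taken to be a nontrivial continuum; in particular $X$ itself then has an essential family of cardinality $\kappa$. Here a *continuum* is a nonempty compact connected Hausdorff space. A compact Hausdorff space is *hereditarily indecomposable* if, whenever two of its subcontinua meet, one is contained in the other. The *weight* of a space is the least cardinality of a base for its topology. A *partition* between disjoint closed sets $A$ and $B$ in a space $Y$ is a set $L=Y\setminus(U\cup V)$ with $U,V$ disjoint open sets, $A\subseteq U$ and $B\subseteq V$. A family $\{(A_i,B_i):i\in I\}$ of pairs of disjoint closed subsets of $Y$ is *essential* in $Y$ if $\bigcap_{i\in I}L_i\neq\emptyset$ for every choice of partitions $L_i$ between $A_i$ and $B_i$ in $Y$ $(i\in I)$. -/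

import Mathlib

open Cardinal Set TopologicalSpace

universe u

/-- The weight of a topological space: the least cardinality of a base. -/
noncomputable def topWeight (X : Type u) [TopologicalSpace X] : Cardinal.{u} :=
  sInf {c | ∃ B : Set (Set X), IsTopologicalBasis B ∧ #B = c}

/-- A subcontinuum of a Hausdorff space: a nonempty compact connected subset. -/
def IsSubcontinuum {X : Type u} [TopologicalSpace X] (C : Set X) : Prop :=
  IsCompact C ∧ IsConnected C

/-- Hereditary indecomposability of a (not necessarily connected) compact Hausdorff space:
whenever two continua in the space meet, one is contained in the other. -/
def HereditarilyIndecomposable (X : Type u) [TopologicalSpace X] : Prop :=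
  ∀ C D : Set X, IsSubcontinuum C → IsSubcontinuum D → (C ∩ D).Nonempty → C ⊆ D ∨ D ⊆ C

/-- `L` is a partition between `A` and `B`: its complement is the union of two disjoint open
sets, one containing `A` and the other containing `B`. -/
def IsPartitionBetween {X : Type u} [TopologicalSpace X] (L A B : Set X) : Prop :=
  ∃ U V : Set X, IsOpen U ∧ IsOpen V ∧ A ⊆ U ∧ B ⊆ V ∧ Disjoint U V ∧ L = (U ∪ V)ᶜ

/-- A family of pairs of disjoint closed sets is essential if any choice of partitions, one for
each pair, has nonempty intersection. -/
structure IsEssentialFamily {X : Type u} [TopologicalSpace X] {ι : Type u}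
    (A B : ι → Set X) : Prop where
  isClosed_left : ∀ i, IsClosed (A i)
  isClosed_right : ∀ i, IsClosed (B i)
  disjoint : ∀ i, Disjoint (A i) (B i)
  nonempty_iInter : ∀ L : ι → Set X, (∀ i, IsPartitionBetween (L i) (A i) (B i)) →
    (⋂ i, L i).Nonempty

/-- `X` has an essential family consisting of `κ` many (distinct) pairs. -/
def HasEssentialFamily (X : Type u) [TopologicalSpace X] (κ : Cardinal.{u}) : Prop :=
  ∃ (ι : Type u) (A B : ι → Set X), #ι = κ ∧ Function.Injective (fun i => (A i, B i)) ∧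
    IsEssentialFamily A B

/-!
For infinite `κ` the space is a continuum in a Tychonoff cube `[-2, 2]^T` whose coordinates are
attached to a dense family of functions `q` on the cube itself.

* The coordinate `t` with task `fold q` solves `4t³ - 3t = q`. If continua `K ∋ a` and `M ∋ b`
  met in `c` with `a ∉ M` and `b ∉ K`, choose `q` close to `-2` at `a`, close to `2` at `b`, at
  most about `0` on `K` and at least about `0` on `M`. The fold forces `t(c) < -1/2` along `K` and
  `t(c) > 1/2` along `M`.
* Attached to `q` is also a cube with `κ` directions, whose pairs of opposite faces form the
  essential family. For each finite choice `α` of candidate partitions, a strip coordinate goes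
  from `-2` to `2` as `q` goes from `-1` to `1`, and all functions of `α` vanish where it is
  strictly in between. A continuum on which `q` takes values on both sides meets this strip, hence
  meets the common zero set of `α`.

These requirements, together with the vanishing of any function separating the two faces of one
extra free coordinate, form a system with one equation per coordinate, to which the
Poincaré–Miranda theorem applies. So every such function has a zero among the points satisfying the
requirements, and these therefore contain a continuum joining the two free faces.

Poincaré–Miranda reduces to a cubical Sperner lemma: for `0`-`1`-labelings `s i` of the grid that
are `0` and `1` on the two faces in direction `i`, the mod 2 cup product of the coboundaries `ds i`
sums to `1` over the grid by Stokes, so some unit cube carries both labels in every direction.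

For finite `κ` a discrete space has no nontrivial subcontinua.
-/

section Weight

variable {X : Type u} [TopologicalSpace X]

lemma topWeight_le_mk {B : Set (Set X)} (hB : IsTopologicalBasis B) : topWeight X ≤ #B :=
  csInf_le (OrderBot.bddBelow _) ⟨B, hB, rfl⟩

lemma exists_isTopologicalBasis_mk_eq_topWeight (X : Type u) [TopologicalSpace X] :
    ∃ B : Set (Set X), IsTopologicalBasis B ∧ #B = topWeight X :=
  csInf_mem (s := {c | ∃ B : Set (Set X), IsTopologicalBasis B ∧ #B = c})
    ⟨_, _, isTopologicalBasis_opens, rfl⟩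

lemma topWeight_le_of_isInducing {Y : Type u} [TopologicalSpace Y] {f : X → Y}
    (hf : Topology.IsInducing f) : topWeight X ≤ topWeight Y := by
  obtain ⟨B, hB, hcard⟩ := exists_isTopologicalBasis_mk_eq_topWeight Y
  exact hcard ▸ (topWeight_le_mk (hB.isInducing hf)).trans mk_image_le

lemma topWeight_eq_mk_of_discreteTopology (X : Type u) [TopologicalSpace X] [DiscreteTopology X] :
    topWeight X = #X := by
  refine le_antisymm ?_ ?_
  · have hrange : {s : Set X | ∃ x, s = {x}} = range fun x => {x} := by
      ext s
      exact exists_congr fun x => eq_comm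
    exact (topWeight_le_mk (isTopologicalBasis_singletons X)).trans (hrange ▸ mk_range_le)
  · obtain ⟨B, hB, hcard⟩ := exists_isTopologicalBasis_mk_eq_topWeight X
    have hsing (x : X) : {x} ∈ B := by
      obtain ⟨b, hb, hxb, hbx⟩ := hB.exists_subset_of_mem_open (mem_singleton x)
        (isOpen_discrete {x})
      rwa [hbx.antisymm (singleton_subset_iff.2 hxb)] at hb
    exact hcard ▸ mk_le_of_injective (f := fun x => (⟨{x}, hsing x⟩ : B)) fun x y h => by
      simpa using h

lemma exists_lt_neg_one_and_one_lt_of_denseRange {K P : Type*} [TopologicalSpace K]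
    [CompactSpace K] [T2Space K] {φ : P → C(K, ℝ)} (hφ : DenseRange φ) {A B : Set K}
    (hA : IsClosed A) (hB : IsClosed B) (hAB : Disjoint A B) :
    ∃ p, (∀ x ∈ A, φ p x < -1) ∧ ∀ x ∈ B, 1 < φ p x := by
  obtain ⟨f, hfA, hfB, -⟩ := exists_bounded_mem_Icc_of_closed_of_le hA hB hAB
    (show (-2 : ℝ) ≤ 2 by norm_num)
  obtain ⟨p, hp⟩ := hφ.exists_dist_lt f.toContinuousMap one_pos
  have hfp (x : K) : |f x - φ p x| < 1 := (ContinuousMap.dist_apply_le_dist x).trans_lt hp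
  refine ⟨p, fun x hx => ?_, fun x hx => ?_⟩
  · have hfx : f x = -2 := hfA hx
    linarith [(abs_lt.1 (hfp x)).1]
  · have hfx : f x = 2 := hfB hx
    linarith [(abs_lt.1 (hfp x)).2]

lemma topWeight_le_of_denseRange {P : Type u} [CompactSpace X] [T2Space X] {φ : P → C(X, ℝ)}
    (hφ : DenseRange φ) : topWeight X ≤ #P := by
  have hbasis : IsTopologicalBasis (range fun p => {x | 0 < φ p x}) := by
    refine isTopologicalBasis_of_isOpen_of_nhds ?_ fun x U hx hU => ?_
    · rintro _ ⟨p, rfl⟩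
      exact isOpen_lt continuous_const (φ p).continuous
    · obtain ⟨p, hpU, hpx⟩ := exists_lt_neg_one_and_one_lt_of_denseRange hφ hU.isClosed_compl
        (isClosed_singleton (x := x)) (by simpa using hx)
      refine ⟨_, ⟨p, rfl⟩, one_pos.trans (hpx x rfl), fun y hy => ?_⟩
      by_contra hyU
      exact lt_asymm hy ((hpU y hyU).trans (by norm_num))
  exact (topWeight_le_mk hbasis).trans mk_range_le

end Weight

section EssentialFamily

variable {X : Type u} [TopologicalSpace X]

lemma exists_isPartitionBetween [NormalSpace X] {A B : Set X} (hA : IsClosed A) (hB : IsClosed B)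
    (hAB : Disjoint A B) : ∃ L, IsPartitionBetween L A B :=
  let ⟨U, V, hU, hV, hAU, hBV, hUV⟩ := normal_separation hA hB hAB
  ⟨_, U, V, hU, hV, hAU, hBV, hUV, rfl⟩

lemma isPartitionBetween_levelSet {A B : Set X} {f : X → ℝ} (hf : Continuous f) {c : ℝ}
    (hA : ∀ x ∈ A, f x < c) (hB : ∀ x ∈ B, c < f x) : IsPartitionBetween {x | f x = c} A B := by
  refine ⟨{x | f x < c}, {x | c < f x}, isOpen_lt hf continuous_const,
    isOpen_lt continuous_const hf, hA, hB, ?_, ?_⟩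
  · exact disjoint_left.2 fun x (hx : f x < c) (hx' : c < f x) => lt_asymm hx hx'
  · ext x
    change f x = c ↔ ¬ (f x < c ∨ c < f x)
    rw [← ne_iff_lt_or_gt, not_ne_iff]

-- Otherwise one function separates both pairs, and two of its level sets are disjoint partitions.
lemma IsEssentialFamily.not_disjoint_union [NormalSpace X] {ι : Type u} {A B : ι → Set X}
    (h : IsEssentialFamily A B) {i j : ι} (hij : i ≠ j) : ¬ Disjoint (A i ∪ A j) (B i ∪ B j) := by
  classical
  intro hd
  obtain ⟨f, hfA, hfB, -⟩ := exists_continuous_zero_one_of_isClosed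
    ((h.isClosed_left i).union (h.isClosed_left j))
    ((h.isClosed_right i).union (h.isClosed_right j)) hd
  have hlevel {k : ι} (hkA : A k ⊆ A i ∪ A j) (hkB : B k ⊆ B i ∪ B j) {c : ℝ} (h₀ : 0 < c)
      (h₁ : c < 1) : IsPartitionBetween {x | f x = c} (A k) (B k) :=
    isPartitionBetween_levelSet f.continuous (fun x hx => (hfA (hkA hx)).trans_lt h₀)
      fun x hx => h₁.trans_eq (hfB (hkB hx)).symm
  choose L hL using fun k => exists_isPartitionBetween (h.isClosed_left k) (h.isClosed_right k)
    (h.disjoint k)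
  let L' := Function.update (Function.update L i {x | f x = 1 / 3}) j {x | f x = 2 / 3}
  have hL' (k : ι) : IsPartitionBetween (L' k) (A k) (B k) := by
    obtain rfl | hkj := eq_or_ne k j
    · simpa [L'] using hlevel subset_union_right subset_union_right (c := 2 / 3) (by norm_num)
        (by norm_num)
    obtain rfl | hki := eq_or_ne k i
    · simpa [L', hkj] using hlevel subset_union_left subset_union_left (c := 1 / 3) (by norm_num)
        (by norm_num)
    · simpa [L', hkj, hki] using hL k
  obtain ⟨x, hx⟩ := h.nonempty_iInter L' hL'
  have hxi : f x = 1 / 3 := by simpa [L', hij] using mem_iInter.1 hx i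
  have hxj : f x = 2 / 3 := by simpa [L'] using mem_iInter.1 hx j
  norm_num [hxi] at hxj

lemma IsEssentialFamily.injective [NormalSpace X] {ι : Type u} {A B : ι → Set X}
    (h : IsEssentialFamily A B) : Function.Injective fun i => (A i, B i) := by
  intro i j hij
  obtain ⟨hA, hB⟩ := Prod.mk.inj hij
  by_contra hne
  refine h.not_disjoint_union hne ?_
  rw [hA, hB, union_self, union_self]
  exact h.disjoint j

lemma exists_finset_isTopologicalBasis_between {B : Set (Set X)} (hB : IsTopologicalBasis B)
    {K U : Set X} (hK : IsCompact K) (hU : IsOpen U) (hKU : K ⊆ U) :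
    ∃ P : Finset B, K ⊆ (⋃ b ∈ P, (b : Set X)) ∧ (⋃ b ∈ P, (b : Set X)) ⊆ U := by
  classical
  obtain ⟨t, ht⟩ := hK.elim_finite_subcover (fun b : {b : B // (b : Set X) ⊆ U} => (b.1 : Set X))
    (fun b => hB.isOpen b.1.2) fun x hx =>
      let ⟨b, hb, hxb, hbU⟩ := hB.exists_subset_of_mem_open (hKU hx) hU
      mem_iUnion.2 ⟨⟨⟨b, hb⟩, hbU⟩, hxb⟩
  refine ⟨t.image Subtype.val, fun x hx => ?_, iUnion₂_subset fun b hb => ?_⟩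
  · obtain ⟨b, hb, hxb⟩ := mem_iUnion₂.1 (ht hx)
    exact mem_iUnion₂.2 ⟨b.1, Finset.mem_image_of_mem _ hb, hxb⟩
  · obtain ⟨c, -, rfl⟩ := Finset.mem_image.1 hb
    exact c.2

theorem HasEssentialFamily.le_topWeight [CompactSpace X] [T2Space X] {κ : Cardinal.{u}}
    (hκ : ℵ₀ ≤ κ) (h : HasEssentialFamily X κ) : κ ≤ topWeight X := by
  obtain ⟨ι, C, D, hι, -, hess⟩ := h
  obtain ⟨B, hB, hcard⟩ := exists_isTopologicalBasis_mk_eq_topWeight X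
  let cover (P : Finset B) : Set X := ⋃ b ∈ P, (b : Set X)
  have hsep (i : ι) : ∃ p : Finset B × Finset B,
      C i ⊆ cover p.1 ∧ D i ⊆ cover p.2 ∧ Disjoint (cover p.1) (cover p.2) := by
    obtain ⟨U, V, hU, hV, hCU, hDV, hUV⟩ :=
      normal_separation (hess.isClosed_left i) (hess.isClosed_right i) (hess.disjoint i)
    obtain ⟨P, hCP, hPU⟩ := exists_finset_isTopologicalBasis_between hB
      (hess.isClosed_left i).isCompact hU hCU
    obtain ⟨Q, hDQ, hQV⟩ := exists_finset_isTopologicalBasis_between hB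
      (hess.isClosed_right i).isCompact hV hDV
    exact ⟨(P, Q), hCP, hDQ, hUV.mono hPU hQV⟩
  choose p hC hD hdisj using hsep
  have hinj : Function.Injective p := fun i j hij => by
    by_contra hne
    exact hess.not_disjoint_union hne ((hdisj i).mono (union_subset (hC i) (hij ▸ hC j))
      (union_subset (hD i) (hij ▸ hD j)))
  by_contra! hlt
  have hfinset : #(Finset B) < κ := by
    rcases finite_or_infinite B with hfin | hinf
    · exact (lt_aleph0_of_finite _).trans_le hκ
    · rwa [mk_finset_of_infinite, hcard]
  have hprod : #(Finset B × Finset B) < #ι := by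
    rw [hι, mk_prod, lift_id]
    exact mul_lt_of_lt hκ hfinset hfinset
  exact hprod.not_ge (mk_le_of_injective hinj)

-- If partitions between `A i` and `B i` had empty intersection, finitely many of the open sets
-- `U i ∪ V i` would cover, and shrinking this cover would enlarge `A i` and `B i` to a cover.
theorem isEssentialFamily_of_forall_finset [CompactSpace X] [NormalSpace X] {ι : Type u}
    {A B : ι → Set X} (hA : ∀ i, IsClosed (A i)) (hB : ∀ i, IsClosed (B i))
    (hAB : ∀ i, Disjoint (A i) (B i))
    (h : ∀ (F : Finset ι) (C D : F → Set X), (∀ i, IsClosed (C i)) → (∀ i, IsClosed (D i)) →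
      (∀ i : F, A i ⊆ C i) → (∀ i : F, B i ⊆ D i) → (∀ i, Disjoint (C i) (D i)) →
      ∃ x, ∀ i, x ∉ C i ∧ x ∉ D i) : IsEssentialFamily A B := by
  refine ⟨hA, hB, hAB, fun L hL => ?_⟩
  choose U V hU hV hAU hBV hUV hLUV using hL
  by_contra hempty
  have hcover : Set.univ ⊆ ⋃ i, U i ∪ V i := fun x _ => by
    by_contra hx
    refine hempty ⟨x, mem_iInter.2 fun i => ?_⟩
    rw [hLUV]
    exact fun hxi => hx (mem_iUnion.2 ⟨i, hxi⟩)
  obtain ⟨F, hF⟩ := isCompact_univ.elim_finite_subcover _ (fun i => (hU i).union (hV i)) hcover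
  obtain ⟨E, hE, hEc, hEUV⟩ := exists_iUnion_eq_closed_subset (u := fun i : F => U i ∪ V i)
    (fun i => (hU i).union (hV i)) (fun x => toFinite _)
    (by rwa [← univ_subset_iff, iUnion_subtype])
  obtain ⟨x, hx⟩ := h F (fun i => A i ∪ E i \ V i) (fun i => B i ∪ E i \ U i)
    (fun i => (hA i).union ((hEc i).sdiff (hV i))) (fun i => (hB i).union ((hEc i).sdiff (hU i)))
    (fun i => subset_union_left) (fun i => subset_union_left) fun i => by
      rw [disjoint_left]
      rintro y (hyA | ⟨hyE, hyV⟩) (hyB | ⟨-, hyU⟩)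
      · exact disjoint_left.1 (hAB i) hyA hyB
      · exact hyU (hAU i hyA)
      · exact hyV (hBV i hyB)
      · exact (hEUV i hyE).elim hyU hyV
  obtain ⟨i, hxE⟩ := mem_iUnion.1 (hE ▸ Set.mem_univ x)
  have hxV : x ∈ V i := by_contra fun hxV => (hx i).1 (Or.inr ⟨hxE, hxV⟩)
  have hxU : x ∈ U i := by_contra fun hxU => (hx i).2 (Or.inr ⟨hxE, hxU⟩)
  exact disjoint_left.1 (hUV i) hxU hxV

end EssentialFamily

section Continua

lemma exists_isClopen_of_notMem_connectedComponent {X : Type*} [TopologicalSpace X]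
    [CompactSpace X] [T2Space X] {A B : Set X} (hA : IsClosed A) (hB : IsClosed B)
    (h : ∀ a ∈ A, ∀ b ∈ B, b ∉ connectedComponent a) :
    ∃ Z : Set X, IsClopen Z ∧ A ⊆ Z ∧ Disjoint Z B := by
  have hc := ConnectedComponents.continuous_coe (α := X)
  have himage : ConnectedComponents.mk '' A ⊆ (ConnectedComponents.mk '' B)ᶜ := by
    rintro _ ⟨a, ha, rfl⟩ ⟨b, hb, hba⟩
    exact h a ha b hb (ConnectedComponents.coe_eq_coe'.1 hba)
  obtain ⟨C, hC, hAC, hCB⟩ := exists_clopen_of_closed_subset_open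
    (hA.isCompact.image hc).isClosed (hB.isCompact.image hc).isClosed.isOpen_compl himage
  exact ⟨_, hC.preimage hc, fun a ha => hAC (mem_image_of_mem _ ha),
    disjoint_left.2 fun x hx hxB => hCB hx (mem_image_of_mem _ hxB)⟩

variable {X : Type u} [TopologicalSpace X] [CompactSpace X] [T2Space X]

theorem exists_isSubcontinuum_of_forall_exists_eq_zero {C A B : Set X} (hC : IsClosed C)
    (hA : IsClosed A) (hB : IsClosed B) (hAB : Disjoint A B)
    (h : ∀ f : C(X, ℝ), (∀ x ∈ A, f x = -1) → (∀ x ∈ B, f x = 1) → ∃ x ∈ C, f x = 0) :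
    ∃ M ⊆ C, IsSubcontinuum M ∧ (M ∩ A).Nonempty ∧ (M ∩ B).Nonempty := by
  have := isCompact_iff_compactSpace.1 hC.isCompact
  by_contra! hM
  obtain ⟨Z, hZ, hAZ, hZB⟩ := exists_isClopen_of_notMem_connectedComponent
    (hA.preimage (continuous_subtype_val (p := (· ∈ C)))) (hB.preimage continuous_subtype_val)
    fun a ha b hb hab => (hM ((↑) '' connectedComponent a) (Subtype.coe_image_subset C _)
      ⟨isClosed_connectedComponent.isCompact.image continuous_subtype_val,
        isConnected_connectedComponent.image _ continuous_subtype_val.continuousOn⟩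
      ⟨a, mem_image_of_mem _ mem_connectedComponent, ha⟩).subset ⟨mem_image_of_mem _ hab, hb⟩
  have hclosed {S : Set C} (hS : IsClosed S) : IsClosed (((↑) : C → X) '' S) :=
    hC.isClosedMap_subtype_val _ hS
  obtain ⟨f, hfA, hfB, -⟩ := exists_bounded_mem_Icc_of_closed_of_le
    (hA.union (hclosed hZ.isClosed)) (hB.union (hclosed hZ.compl.isClosed)) (by
      rw [disjoint_left]
      rintro x (hxA | ⟨x, hxZ, rfl⟩) (hxB | ⟨y, hyZ, hyx⟩)
      · exact disjoint_left.1 hAB hxA hxB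
      · exact hyZ (hAZ (show (y : X) ∈ A from hyx ▸ hxA))
      · exact disjoint_left.1 hZB hxZ hxB
      · exact hyZ (Subtype.val_injective hyx ▸ hxZ)) (show (-1 : ℝ) ≤ 1 by norm_num)
  obtain ⟨x, hxC, hfx⟩ := h f.toContinuousMap (fun x hx => hfA (Or.inl hx))
    fun x hx => hfB (Or.inl hx)
  change f x = 0 at hfx
  by_cases hxZ : ⟨x, hxC⟩ ∈ Z
  · have hfx' : f x = -1 := hfA (Or.inr (mem_image_of_mem _ hxZ))
    norm_num [hfx'] at hfx
  · have hfx' : f x = 1 := hfB (Or.inr ⟨⟨x, hxC⟩, hxZ, rfl⟩)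
    norm_num [hfx'] at hfx

end Continua

section Folding

-- `4t³ - 3t` is the Chebyshev polynomial `T₃`: it folds `[-1, 1]` onto itself three times, with
-- turning points `T₃(-1/2) = 1` and `T₃(1/2) = -1`, and `T₃ + 1 = (t + 1)(2t - 1)²`.
lemma lt_neg_half_of_isPreconnected_of_cubic_lt_one {X : Type*} [TopologicalSpace X] {K : Set X}
    (hK : IsPreconnected K) {t : X → ℝ} (ht : ContinuousOn t K)
    (hlt : ∀ x ∈ K, 4 * t x ^ 3 - 3 * t x < 1) {a c : X} (ha : a ∈ K) (hc : c ∈ K)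
    (hta : 4 * t a ^ 3 - 3 * t a < -1) : t c < -(1 / 2) := by
  have hta' : t a < -1 := by
    by_contra! h
    nlinarith [mul_nonneg (neg_le_iff_add_nonneg.1 h) (sq_nonneg (2 * t a - 1))]
  by_contra! h
  obtain ⟨x, hx, htx⟩ := hK.intermediate_value ha hc ht ⟨by linarith, h⟩
  have hlt := hlt x hx
  rw [htx] at hlt
  norm_num at hlt

theorem hereditarilyIndecomposable_of_forall_exists_cubic_lift {X : Type u} [TopologicalSpace X]
    [T4Space X]
    (h : ∀ g : C(X, ℝ), (∀ x, |g x| ≤ 2) →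
      ∃ t : C(X, ℝ), ∀ x, |4 * t x ^ 3 - 3 * t x - g x| < 1) :
    HereditarilyIndecomposable X := by
  rintro K M hK hM ⟨c, hcK, hcM⟩
  by_contra! hcon
  obtain ⟨⟨a, haK, haM⟩, ⟨b, hbM, hbK⟩⟩ := And.imp not_subset.1 not_subset.1 hcon
  have hbump {E : Set X} (hE : IsClosed E) {y : X} (hy : y ∉ E) :
      ∃ u : C(X, ℝ), (∀ x ∈ E, u x = 0) ∧ u y = 2 ∧ ∀ x, u x ∈ Icc 0 2 := by
    obtain ⟨u, huE, huy, hu⟩ := exists_bounded_mem_Icc_of_closed_of_le hE isClosed_singleton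
      (disjoint_singleton_right.2 hy) zero_le_two
    exact ⟨u.toContinuousMap, huE, huy rfl, hu⟩
  obtain ⟨u, huM, hua, hu⟩ := hbump hM.1.isClosed haM
  obtain ⟨v, hvK, hvb, hv⟩ := hbump hK.1.isClosed hbK
  obtain ⟨t, ht⟩ := h (v - u) fun x => by
    rw [ContinuousMap.sub_apply, abs_le]
    constructor <;> linarith [(hu x).1, (hu x).2, (hv x).1, (hv x).2]
  simp only [ContinuousMap.sub_apply, abs_lt] at ht
  have hcK' : t c < -(1 / 2) := by
    refine lt_neg_half_of_isPreconnected_of_cubic_lt_one hK.2.isPreconnected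
      t.continuous.continuousOn (fun x hx => ?_) haK hcK ?_
    · linarith [(ht x).2, hvK x hx, (hu x).1]
    · linarith [(ht a).2, hvK a haK]
  have hcM' : -t c < -(1 / 2) := by
    refine lt_neg_half_of_isPreconnected_of_cubic_lt_one hM.2.isPreconnected (t := -t)
      t.continuous.neg.continuousOn (fun x hx => ?_) hbM hcM ?_ <;>
      rw [Pi.neg_apply, Odd.neg_pow (by decide)]
    · linarith [(ht x).1, huM x hx, (hv x).1]
    · linarith [(ht b).1, huM b hbM]
  linarith

end Folding

section RationalStoneWeierstrass

lemma denseRange_aeval_of_separatesPoints {K S : Type*} [TopologicalSpace K] [CompactSpace K]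
    {f : S → C(K, ℝ)} (hf : ∀ x y : K, x ≠ y → ∃ s, f s x ≠ f s y) :
    DenseRange (MvPolynomial.aeval (R := ℚ) f) := by
  let R : Subring C(K, ℝ) := (MvPolynomial.aeval (R := ℚ) f).toRingHom.range.topologicalClosure
  have haeval (q : MvPolynomial S ℚ) : MvPolynomial.aeval f q ∈ R :=
    Subring.le_topologicalClosure _ ⟨q, rfl⟩
  let A : Subalgebra ℝ C(K, ℝ) :=
    { R with
      algebraMap_mem' := fun r => by
        refine map_mem_closure ContinuousMap.continuous_const'
          (Rat.isDenseEmbedding_coe_real.dense r) ?_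
        rintro _ ⟨x, rfl⟩
        refine ⟨MvPolynomial.C x, ?_⟩
        ext w
        simp }
  have hsep : A.SeparatesPoints := fun x y hxy => by
    obtain ⟨s, hs⟩ := hf x y hxy
    exact ⟨_, ⟨f s, MvPolynomial.aeval_X (R := ℚ) f s ▸ haeval (MvPolynomial.X s), rfl⟩, hs⟩
  have hA : (A : Set C(K, ℝ)) = closure (range (MvPolynomial.aeval (R := ℚ) f)) := rfl
  have htop := ContinuousMap.subalgebra_topologicalClosure_eq_top_of_separatesPoints A hsep
  intro g
  have hg : g ∈ closure (A : Set C(K, ℝ)) := htop.ge (Algebra.mem_top (R := ℝ))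
  rwa [hA, closure_closure] at hg

end RationalStoneWeierstrass

section CupProduct

open scoped fwdDiff

variable {ι M R : Type*} [DecidableEq ι] [AddCommMonoid M] [CommRing R]

/-- The value of the cup product `ds₁ ⌣ ⋯ ⌣ dsₖ` of the coboundaries of the functions `s₁, …, sₖ`
on the cube with corner `v` spanned by the vectors `e i`, `i ∈ I`. It is used for lists of length
`#I`; signs are omitted, so it is a cochain-level product only in characteristic two. -/
def cupDiff (e : ι → M) : List (M → R) → Finset ι → M → R
  | [], _, _ => 1
  | s :: l, I, v => ∑ i ∈ I, Δ_[e i] s v * cupDiff e l (I.erase i) (v + e i)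

lemma sum_sum_erase_eq_zero_of_symm [CharP R 2] (I : Finset ι) {f : ι → ι → R}
    (hf : ∀ i j, f i j = f j i) : ∑ i ∈ I, ∑ j ∈ I.erase i, f i j = 0 := by
  have hoff : ∑ i ∈ I, ∑ j ∈ I.erase i, f i j = ∑ p ∈ I.offDiag, f p.1 p.2 :=
    (Finset.sum_finset_product' _ _ _ fun p => by
      simp only [Finset.mem_offDiag, Finset.mem_erase]; tauto).symm
  rw [hoff]
  refine Finset.sum_involution (fun p _ => p.swap) (fun p _ => ?_) (fun p hp _ => ?_)
    (fun p hp => ?_) (fun p _ => p.swap_swap)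
  · rw [Prod.fst_swap, Prod.snd_swap, hf p.2, CharTwo.add_self_eq_zero]
  · exact fun h => (Finset.mem_offDiag.1 hp).2.2 (congrArg Prod.snd h)
  · simpa only [Finset.mem_offDiag, Prod.fst_swap, Prod.snd_swap, ne_comm, and_left_comm] using hp

theorem sum_fwdDiff_cupDiff_erase [CharP R 2] (e : ι → M) (l : List (M → R)) (I : Finset ι)
    (v : M) : ∑ i ∈ I, Δ_[e i] (cupDiff e l (I.erase i)) v = 0 := by
  induction l generalizing I v with
  | nil => simp [fwdDiff, cupDiff]
  | cons s l ih =>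
    have hsplit (i) : Δ_[e i] (cupDiff e (s :: l) (I.erase i)) v =
        ∑ k ∈ I.erase i, Δ_[e i] (Δ_[e k] s) v * cupDiff e l ((I.erase i).erase k) (v + e i + e k) +
        ∑ k ∈ I.erase i, Δ_[e k] s v * Δ_[e i] (cupDiff e l ((I.erase k).erase i)) (v + e k) := by
      rw [← Finset.sum_add_distrib]
      simp only [fwdDiff, cupDiff, ← Finset.sum_sub_distrib]
      refine Finset.sum_congr rfl fun k _ => ?_
      rw [Finset.erase_right_comm, add_right_comm v (e k)]
      ring
    have hsymm (i k : ι) :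
        Δ_[e i] (Δ_[e k] s) v * cupDiff e l ((I.erase i).erase k) (v + e i + e k) =
        Δ_[e k] (Δ_[e i] s) v * cupDiff e l ((I.erase k).erase i) (v + e k + e i) := by
      simp only [fwdDiff]
      rw [Finset.erase_right_comm, add_right_comm v (e i)]
      ring
    rw [Finset.sum_congr rfl fun i _ => hsplit i, Finset.sum_add_distrib,
      sum_sum_erase_eq_zero_of_symm I hsymm, zero_add,
      Finset.sum_comm' (t' := I) (s' := fun k => I.erase k) fun i k => by
        simp only [Finset.mem_erase]; tauto]
    simp only [← Finset.mul_sum, ih, mul_zero, Finset.sum_const_zero]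

theorem cupDiff_cons_eq_sum_fwdDiff [CharP R 2] (e : ι → M) (s : M → R) (l : List (M → R))
    (I : Finset ι) (v : M) :
    cupDiff e (s :: l) I v = ∑ i ∈ I, Δ_[e i] (s * cupDiff e l (I.erase i)) v := by
  have leibniz (i : ι) : Δ_[e i] (s * cupDiff e l (I.erase i)) v =
      Δ_[e i] s v * cupDiff e l (I.erase i) (v + e i) +
        s v * Δ_[e i] (cupDiff e l (I.erase i)) v := by
    simp only [fwdDiff, Pi.mul_apply]
    ring
  rw [Finset.sum_congr rfl fun i _ => leibniz i, Finset.sum_add_distrib, ← Finset.mul_sum,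
    sum_fwdDiff_cupDiff_erase, mul_zero, add_zero, cupDiff]

lemma exists_ne_of_cupDiff_ne_zero [PartialOrder M] [IsOrderedAddMonoid M]
    [CanonicallyOrderedAdd M] {e : ι → M} {l : List (M → R)} {I : Finset ι} {v : M}
    (h : cupDiff e l I v ≠ 0) {s : M → R} (hs : s ∈ l) :
    ∃ w ∈ Icc v (v + ∑ i ∈ I, e i), ∃ w' ∈ Icc v (v + ∑ i ∈ I, e i), s w ≠ s w' := by
  induction l generalizing I v with
  | nil => simp at hs
  | cons t l ih =>
    obtain ⟨i, hi, hne⟩ := Finset.exists_ne_zero_of_sum_ne_zero h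
    have hend : v + e i + ∑ k ∈ I.erase i, e k = v + ∑ k ∈ I, e k := by
      rw [add_assoc, Finset.add_sum_erase I e hi]
    have hle : v + e i ≤ v + ∑ k ∈ I, e k := hend ▸ le_self_add
    rcases List.mem_cons.1 hs with rfl | hs
    · exact ⟨v + e i, ⟨le_self_add, hle⟩, v, ⟨le_rfl, le_self_add⟩,
        sub_ne_zero.1 (left_ne_zero_of_mul hne)⟩
    · obtain ⟨w, hw, w', hw', hww'⟩ := ih (right_ne_zero_of_mul hne) hs
      rw [hend] at hw hw'
      exact ⟨w, ⟨le_self_add.trans hw.1, hw.2⟩, w', ⟨le_self_add.trans hw'.1, hw'.2⟩, hww'⟩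

lemma cupDiff_map_eq_zero_of_const {s : ι → (ι → ℕ) → R} {l : List ι} {I : Finset ι} {i : ι}
    (hl : i ∈ l) (hI : i ∉ I) {v : ι → ℕ} {c : R} (hs : ∀ w, w i = v i → s i w = c) :
    cupDiff (fun k => Pi.single k 1) (l.map s) I v = 0 := by
  by_contra h
  obtain ⟨w, hw, w', hw', hne⟩ := exists_ne_of_cupDiff_ne_zero h (List.mem_map_of_mem hl)
  have happly {w : ι → ℕ} (hw : w ∈ Icc v (v + ∑ k ∈ I, Pi.single k 1)) : w i = v i := by
    refine le_antisymm ?_ (hw.1 i)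
    have hzero : ∑ k ∈ I, (Pi.single k 1 : ι → ℕ) i = 0 := Finset.sum_eq_zero fun k hk =>
      Pi.single_eq_of_ne (ne_of_mem_of_not_mem hk hI).symm 1
    simpa [Finset.sum_apply, hzero] using hw.2 i
  exact hne ((hs w (happly hw)).trans (hs w' (happly hw')).symm)

end CupProduct

section Sperner

open scoped fwdDiff

variable {ι : Type*} [DecidableEq ι] [Fintype ι]

/-- The lower corners of the unit cubes in directions `I` that tile the face `{x | x i = N, i ∉ I}`
of the cube `[0, N]^ι`. -/
def gridBox (N : ℕ) (I : Finset ι) : Finset (ι → ℕ) :=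
  Fintype.piFinset fun i => if i ∈ I then Finset.range N else {N}

lemma apply_of_mem_gridBox {N : ℕ} {I : Finset ι} {v : ι → ℕ} (hv : v ∈ gridBox N I) {i : ι}
    (hi : i ∉ I) : v i = N := by
  simpa [hi] using Fintype.mem_piFinset.1 hv i

lemma sum_gridBox_eq_sum_sum {A : Type*} [AddCommMonoid A] (N : ℕ) {I : Finset ι} {i : ι}
    (hi : i ∈ I) (f : (ι → ℕ) → A) :
    ∑ v ∈ gridBox N I, f v =
      ∑ v ∈ gridBox N (I.erase i), ∑ k ∈ Finset.range N, f (Function.update v i k) := by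
  rw [← Finset.sum_product']
  refine Finset.sum_nbij' (fun v => (Function.update v i N, v i))
    (fun p => Function.update p.1 i p.2) (fun v hv => ?_) (fun p hp => ?_) (fun v _ => by simp)
    (fun p hp => ?_) (fun v _ => by simp)
  · have hv := Fintype.mem_piFinset.1 hv
    refine Finset.mem_product.2 ⟨Fintype.mem_piFinset.2 fun k => ?_, by simpa [hi] using hv i⟩
    obtain rfl | hk := eq_or_ne k i
    · simp
    · simpa [hk] using hv k
  · obtain ⟨hp, hk⟩ := Finset.mem_product.1 hp
    refine Fintype.mem_piFinset.2 fun j => ?_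
    obtain rfl | hj := eq_or_ne j i
    · simpa [hi] using hk
    · simpa [hj] using Fintype.mem_piFinset.1 hp j
  · have hp := apply_of_mem_gridBox (Finset.mem_product.1 hp).1 (Finset.notMem_erase i I)
    ext <;> simp [← hp]

lemma sum_gridBox_fwdDiff {A : Type*} [AddCommGroup A] (N : ℕ) {I : Finset ι} {i : ι}
    (hi : i ∈ I) (g : (ι → ℕ) → A) :
    ∑ v ∈ gridBox N I, Δ_[Pi.single i 1] g v =
      ∑ v ∈ gridBox N (I.erase i), (g v - g (Function.update v i 0)) := by
  rw [sum_gridBox_eq_sum_sum N hi]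
  refine Finset.sum_congr rfl fun v hv => ?_
  have hstep (k : ℕ) :
      Function.update v i k + Pi.single i 1 = Function.update v i (k + 1) := by
    ext j
    obtain rfl | hj := eq_or_ne j i <;> simp [*]
  have hlast : Function.update v i N = v :=
    Function.update_eq_self_iff.2 (apply_of_mem_gridBox hv (Finset.notMem_erase i I)).symm
  simp only [fwdDiff, hstep]
  rw [Finset.sum_range_sub (fun k => g (Function.update v i k)), hlast]

variable {R : Type*} [CommRing R]

theorem sum_gridBox_cupDiff [CharP R 2] {N : ℕ} {s : ι → (ι → ℕ) → R}
    (hs₀ : ∀ i v, v i = 0 → s i v = 0) (hs₁ : ∀ i v, v i = N → s i v = 1) {l : List ι}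
    (hl : l.Nodup) :
    ∑ v ∈ gridBox N l.toFinset, cupDiff (fun k => Pi.single k 1) (l.map s) l.toFinset v = 1 := by
  induction l with
  | nil => simp [gridBox, cupDiff]
  | cons j l ih =>
    obtain ⟨hj, hl⟩ := List.nodup_cons.1 hl
    simp only [List.toFinset_cons, List.map_cons, cupDiff_cons_eq_sum_fwdDiff]
    have herase : (insert j l.toFinset).erase j = l.toFinset :=
      Finset.erase_insert (by simpa using hj)
    rw [Finset.sum_comm, Finset.sum_eq_single_of_mem j (Finset.mem_insert_self _ _),
      sum_gridBox_fwdDiff N (Finset.mem_insert_self _ _), herase, ← ih hl]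
    · refine Finset.sum_congr rfl fun v hv => ?_
      have hvj := apply_of_mem_gridBox hv (i := j) (by simpa using hj)
      simp [hs₀ j (Function.update v j 0), hs₁ j v hvj]
    -- On the faces orthogonal to another direction `i`, the factor `ds i` vanishes.
    · intro i hi hij
      have hil : i ∈ l := by simpa [hij] using hi
      rw [sum_gridBox_fwdDiff N hi]
      refine Finset.sum_eq_zero fun v hv => ?_
      have hvi := apply_of_mem_gridBox hv (Finset.notMem_erase i _)
      have hmem := Finset.notMem_erase i (insert j l.toFinset)
      have h₁ := cupDiff_map_eq_zero_of_const hil hmem fun w hw => hs₁ i w (hw.trans hvi)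
      have h₀ := cupDiff_map_eq_zero_of_const (v := Function.update v i 0) hil hmem
        fun w hw => hs₀ i w (by simpa using hw)
      simp only [Pi.mul_apply, h₁, h₀, mul_zero, sub_zero]

theorem exists_forall_Icc_inter_nonempty_and_not_subset {ι : Type*} [Finite ι] {N : ℕ}
    {L : ι → Set (ι → ℕ)}
    (h₀ : ∀ i v, v i = 0 → v ∈ L i) (h₁ : ∀ i v, v i = N → v ∉ L i) :
    ∃ v : ι → ℕ, ∀ i, (Icc v (v + 1) ∩ L i).Nonempty ∧ ¬ Icc v (v + 1) ⊆ L i := by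
  classical
  have := Fintype.ofFinite ι
  let s (i : ι) (v : ι → ℕ) : ZMod 2 := if v ∈ L i then 0 else 1
  have hsum := sum_gridBox_cupDiff (s := s) (fun i v hv => if_pos (h₀ i v hv))
    (fun i v hv => if_neg (h₁ i v hv)) (Finset.nodup_toList Finset.univ)
  obtain ⟨v, -, hv⟩ := Finset.exists_ne_zero_of_sum_ne_zero (hsum.trans_ne one_ne_zero)
  refine ⟨v, fun i => ?_⟩
  obtain ⟨w, hw, w', hw', hne⟩ := exists_ne_of_cupDiff_ne_zero hv
    (List.mem_map_of_mem (Finset.mem_toList.2 (Finset.mem_univ i)))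
  have hones : ∑ k : ι, Pi.single k 1 = (1 : ι → ℕ) := Finset.univ_sum_single 1
  rw [Finset.toList_toFinset, hones] at hw hw'
  by_cases hwL : w ∈ L i <;> by_cases hwL' : w' ∈ L i
  · simp [s, hwL, hwL'] at hne
  · exact ⟨⟨w, hw, hwL⟩, fun h => hwL' (h hw')⟩
  · exact ⟨⟨w', hw', hwL'⟩, fun h => hwL (h hw)⟩
  · simp [s, hwL, hwL'] at hne

end Sperner

section PoincareMiranda

variable {ι : Type*} {a b : ℝ}

/-- The point of the cube `[a, b]^ι` with coordinates `a + (v i / N) (b - a)`. -/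
noncomputable def gridPoint (hab : a ≤ b) (N : ℕ) (v : ι → ℕ) : ι → Icc a b :=
  fun i => projIcc a b hab (a + v i / N * (b - a))

lemma dist_gridPoint_le [Fintype ι] (hab : a ≤ b) {N : ℕ} {v w : ι → ℕ}
    (hw : w ∈ Icc v (v + 1)) : dist (gridPoint hab N v) (gridPoint hab N w) ≤ (b - a) / N := by
  have hmesh : 0 ≤ (b - a) / N := div_nonneg (sub_nonneg.2 hab) N.cast_nonneg
  refine (dist_pi_le_iff hmesh).2 fun i => (abs_projIcc_sub_projIcc hab).trans ?_
  have hvw : (v i : ℝ) ≤ w i := mod_cast hw.1 i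
  have hwv : (w i : ℝ) ≤ v i + 1 := mod_cast hw.2 i
  calc |a + v i / N * (b - a) - (a + w i / N * (b - a))|
      = |(v i - w i : ℝ)| * ((b - a) / N) := by
        rw [← abs_of_nonneg hmesh, ← abs_mul]
        ring_nf
    _ ≤ 1 * ((b - a) / N) := by
        gcongr
        exact abs_le.2 ⟨by linarith, by linarith⟩
    _ = (b - a) / N := one_mul _

lemma exists_forall_abs_lt_of_sign_change [Finite ι] (hab : a ≤ b) {h : ι → (ι → Icc a b) → ℝ}
    (hc : ∀ j, Continuous (h j)) (h₀ : ∀ j x, (x j : ℝ) = a → h j x ≤ 0)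
    (h₁ : ∀ j x, (x j : ℝ) = b → 0 ≤ h j x) {ε : ℝ} (hε : 0 < ε) : ∃ x, ∀ j, |h j x| < ε := by
  have := Fintype.ofFinite ι
  classical
  obtain ⟨δ, hδ, hclose⟩ := Metric.uniformContinuous_iff.1
    (CompactSpace.uniformContinuous_of_continuous (continuous_pi hc)) ε hε
  obtain ⟨N, hN⟩ := exists_nat_gt ((b - a) / δ)
  have hN₀ : 0 < (N : ℝ) := (div_nonneg (sub_nonneg.2 hab) hδ.le).trans_lt hN
  have hmesh : (b - a) / N < δ := by rwa [div_lt_comm₀ hN₀ hδ]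
  let L (j : ι) : Set (ι → ℕ) := {v | v j ≠ N ∧ (v j = 0 ∨ h j (gridPoint hab N v) ≤ 0)}
  have hneg {j : ι} {v : ι → ℕ} (hv : v ∈ L j) : h j (gridPoint hab N v) ≤ 0 :=
    hv.2.elim (fun hv => h₀ j _ (by simp [gridPoint, hv])) id
  have hpos {j : ι} {v : ι → ℕ} (hv : v ∉ L j) : 0 ≤ h j (gridPoint hab N v) := by
    by_cases hvN : v j = N
    · exact h₁ j _ (by simp [gridPoint, hvN, hN₀.ne'])
    · by_contra hlt
      exact hv ⟨hvN, Or.inr (not_le.1 hlt).le⟩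
  obtain ⟨v, hv⟩ := exists_forall_Icc_inter_nonempty_and_not_subset (N := N) (L := L)
    (fun i v hv => ⟨hv.trans_ne (mod_cast hN₀.ne), Or.inl hv⟩) (fun i v hv hL => hL.1 hv)
  refine ⟨gridPoint hab N v, fun j => ?_⟩
  obtain ⟨⟨w, hw, hwL⟩, hsub⟩ := hv j
  obtain ⟨w', hw', hwL'⟩ := not_subset.1 hsub
  have hdist {w : ι → ℕ} (hw : w ∈ Icc v (v + 1)) :
      |h j (gridPoint hab N v) - h j (gridPoint hab N w)| < ε :=
    (dist_le_pi_dist _ _ j).trans_lt (hclose ((dist_gridPoint_le hab hw).trans_lt hmesh))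
  have hupper := (abs_lt.1 (hdist hw)).2
  have hlower := (abs_lt.1 (hdist hw')).1
  exact abs_lt.2 ⟨by linarith [hpos hwL'], by linarith [hneg hwL]⟩

theorem poincareMiranda_of_finite [Finite ι] (hab : a ≤ b) {h : ι → (ι → Icc a b) → ℝ}
    (hc : ∀ j, Continuous (h j)) (h₀ : ∀ j x, (x j : ℝ) = a → h j x ≤ 0)
    (h₁ : ∀ j x, (x j : ℝ) = b → 0 ≤ h j x) : ∃ x, ∀ j, h j x = 0 := by
  have := Fintype.ofFinite ι
  let H (x : ι → Icc a b) (j : ι) : ℝ := h j x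
  have hclosed : IsClosed (range H) := (isCompact_range (continuous_pi hc)).isClosed
  have hzero : (0 : ι → ℝ) ∈ closure (range H) := Metric.mem_closure_range_iff.2 fun ε hε => by
    obtain ⟨x, hx⟩ := exists_forall_abs_lt_of_sign_change hab hc h₀ h₁ hε
    exact ⟨x, (dist_pi_lt_iff hε).2 fun j => by simpa [H] using hx j⟩
  obtain ⟨x, hx⟩ := hclosed.closure_eq ▸ hzero
  exact ⟨x, congrFun hx⟩

lemma exists_forall_mem_finset_eq_zero (hab : a ≤ b) {h : ι → (ι → Icc a b) → ℝ}
    (hc : ∀ j, Continuous (h j)) (h₀ : ∀ j x, (x j : ℝ) = a → h j x ≤ 0)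
    (h₁ : ∀ j x, (x j : ℝ) = b → 0 ≤ h j x) (F : Finset ι) : ∃ x, ∀ j ∈ F, h j x = 0 := by
  classical
  let extend (y : F → Icc a b) (j : ι) : Icc a b :=
    if hj : j ∈ F then y ⟨j, hj⟩ else ⟨a, left_mem_Icc.2 hab⟩
  have hextend (y : F → Icc a b) (j : F) : extend y j = y j := dif_pos j.2
  have hcont : Continuous extend := continuous_pi fun j => by
    by_cases hj : j ∈ F
    · simpa only [extend, dif_pos hj] using continuous_apply _
    · simpa only [extend, dif_neg hj] using continuous_const
  obtain ⟨y, hy⟩ := poincareMiranda_of_finite hab (h := fun (j : F) y => h j (extend y))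
    (fun j => (hc j).comp hcont) (fun j y hj => h₀ j _ (by rw [hextend, hj]))
    (fun j y hj => h₁ j _ (by rw [hextend, hj]))
  exact ⟨extend y, fun j hj => hy ⟨j, hj⟩⟩

theorem poincareMiranda (hab : a ≤ b) {h : ι → (ι → Icc a b) → ℝ}
    (hc : ∀ j, Continuous (h j)) (h₀ : ∀ j x, (x j : ℝ) = a → h j x ≤ 0)
    (h₁ : ∀ j x, (x j : ℝ) = b → 0 ≤ h j x) : ∃ x, ∀ j, h j x = 0 := by
  obtain ⟨x, hx⟩ : (⋂ j, {x | h j x = 0}).Nonempty :=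
    CompactSpace.iInter_nonempty (fun j => isClosed_eq (hc j) continuous_const) fun F =>
      let ⟨x, hx⟩ := exists_forall_mem_finset_eq_zero hab hc h₀ h₁ F
      ⟨x, mem_iInter₂.2 hx⟩
  exact ⟨x, fun j => mem_iInter.1 hx j⟩

end PoincareMiranda

section Core

/-- The Tychonoff cube `[-2, 2]^T`. -/
abbrev Cube (T : Type*) : Type _ := T → Icc (-2 : ℝ) 2

/-- The coordinates of the ambient cube, by their task. Here `P` indexes a dense family of functions
on the cube itself, and `α : ι →₀ P` lists candidate partitions between opposite faces of a cube
with `ι` directions. The coordinate `fold q` folds along the function `q`, the coordinates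
`face q i` span a cube attached to `q`, and `strip q α` marks the strip reserved for `α` in the
region where `q` is intermediate. -/
inductive Coord (ι P : Type u) [Zero P] : Type u
  | free : Coord ι P
  | fold (q : P) : Coord ι P
  | strip (q : P) (α : ι →₀ P) : Coord ι P
  | face (q : P) (i : ι) : Coord ι P

variable {ι P : Type u} [Zero P] (φ : P → C(Cube (Coord ι P), ℝ))

/-- The zero sets of the functions `α i` may serve as partitions between the opposite faces of the
cube attached to `q`. -/
def SignCompatible (q : P) (α : ι →₀ P) : Prop :=
  ∀ i w, ((w (.face q i) : ℝ) = -2 → φ (α i) w ≤ 0) ∧ ((w (.face q i) : ℝ) = 2 → 0 ≤ φ (α i) w)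

/-- The strip coordinate of `(q, α)` rises from `-2` to `2` as `q` rises from `-1` to `1`, and the
functions `α i` vanish wherever it is properly between these values. -/
structure IsStripAt (w : Cube (Coord ι P)) (q : P) (α : ι →₀ P) : Prop where
  eq_neg_two : φ q w < -1 → (w (.strip q α) : ℝ) = -2
  eq_two : 1 < φ q w → (w (.strip q α) : ℝ) = 2
  eq_zero : |(w (.strip q α) : ℝ)| < 2 → ∀ i, φ (α i) w = 0

/-- The points of the cube at which all coordinates solve their tasks; `G` restricts the strips
taken into account. The bound `26` is the value of `T₃(t) = 4t³ - 3t` at `2`. -/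
def foldedCore (G : Set (ι →₀ P)) : Set (Cube (Coord ι P)) :=
  {w | (∀ q, (∀ x, |φ q x| ≤ 26) →
      4 * (w (.fold q) : ℝ) ^ 3 - 3 * (w (.fold q) : ℝ) = φ q w) ∧
    ∀ q, ∀ α ∈ G, SignCompatible φ q α → IsStripAt φ w q α}

lemma isClosed_foldedCore (G : Set (ι →₀ P)) : IsClosed (foldedCore φ G) := by
  have hstrip (q : P) (α : ι →₀ P) : IsClosed {w | IsStripAt φ w q α} := by
    have hcoe : {w | IsStripAt φ w q α} =
        {w | φ q w < -1 → (w (.strip q α) : ℝ) = -2} ∩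
        ({w | 1 < φ q w → (w (.strip q α) : ℝ) = 2} ∩
        {w | |(w (.strip q α) : ℝ)| < 2 → ∀ i, φ (α i) w = 0}) :=
      Set.ext fun w => ⟨fun h => ⟨h.1, h.2, h.3⟩, fun h => ⟨h.1, h.2.1, h.2.2⟩⟩
    rw [hcoe]
    refine .inter ?_ (.inter ?_ ?_)
    · exact isClosed_imp (isOpen_lt (by fun_prop) (by fun_prop))
        (isClosed_eq (by fun_prop) (by fun_prop))
    · exact isClosed_imp (isOpen_lt (by fun_prop) (by fun_prop))
        (isClosed_eq (by fun_prop) (by fun_prop))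
    · refine isClosed_imp (isOpen_lt (by fun_prop) (by fun_prop)) ?_
      simp only [ofPred_forall]
      exact isClosed_iInter fun i => isClosed_eq (by fun_prop) (by fun_prop)
  simp only [foldedCore, ofPred_and, ofPred_forall]
  refine .inter (isClosed_iInter fun q => isClosed_iInter fun _ => ?_)
    (isClosed_iInter fun q => isClosed_iInter fun α => isClosed_iInter fun _ =>
      isClosed_iInter fun _ => hstrip q α)
  exact isClosed_eq (by fun_prop) (by fun_prop)

lemma foldedCore_univ : foldedCore φ univ = ⋂ G : Finset (ι →₀ P), foldedCore φ G :=
  Set.ext fun w => ⟨fun hw => mem_iInter.2 fun G => ⟨hw.1, fun q α _ => hw.2 q α trivial⟩,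
    fun hw => ⟨(mem_iInter.1 hw ∅).1, fun q α _ => (mem_iInter.1 hw {α}).2 q α (by simp)⟩⟩

lemma foldedCore_anti {G G' : Set (ι →₀ P)} (h : G ⊆ G') : foldedCore φ G' ⊆ foldedCore φ G :=
  fun _ hw => ⟨hw.1, fun q α hα => hw.2 q α (h hα)⟩

lemma exists_staircase {γ : Type*} (G : Finset γ) :
    ∃ σ : γ → ℝ → ℝ, (∀ k, Continuous (σ k)) ∧ (∀ k x, σ k x ∈ Icc (-2) 2) ∧
      (∀ k, ∀ x ≤ 0, σ k x = -2) ∧ (∀ k ∈ G, ∀ x, 1 ≤ x → σ k x = 2) ∧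
      ∀ k ∈ G, ∀ l x, |σ k x| < 2 → |σ l x| < 2 → k = l := by
  classical
  let idx (k : γ) : ℕ := G.toList.idxOf k
  -- The `k`-th function rises from `-2` to `2` on the interval `[idx k / #G, (idx k + 1) / #G]`.
  let σ (k : γ) (x : ℝ) : ℝ := max (-2) (min 2 (4 * (G.card * x - idx k) - 2))
  have hrise {k : γ} {x : ℝ} (h : |σ k x| < 2) :
      0 < G.card * x - idx k ∧ G.card * x - idx k < 1 := by
    obtain ⟨h₁, h₂⟩ := abs_lt.1 h
    obtain h₁ := (lt_max_iff.1 h₁).resolve_left (lt_irrefl _)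
    obtain h₂ := (min_lt_iff.1 (max_lt_iff.1 h₂).2).resolve_left (lt_irrefl _)
    exact ⟨by linarith [(lt_min_iff.1 h₁).2], by linarith⟩
  refine ⟨σ, fun k => by fun_prop, fun k x => ⟨le_max_left _ _, max_le (by norm_num)
    (min_le_left _ _)⟩, fun k x hx => ?_, fun k hk x hx => ?_, fun k hk l x hkx hlx => ?_⟩
  · have hle : G.card * x ≤ 0 := mul_nonpos_of_nonneg_of_nonpos (Nat.cast_nonneg _) hx
    exact max_eq_left ((min_le_right _ _).trans (by linarith [(idx k).cast_nonneg (α := ℝ)]))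
  · have hidx : (idx k : ℝ) + 1 ≤ G.card := by
      rw [← G.length_toList]
      exact_mod_cast List.idxOf_lt_length_iff.2 (Finset.mem_toList.2 hk)
    have hle : (G.card : ℝ) ≤ G.card * x := le_mul_of_one_le_right (Nat.cast_nonneg _) hx
    change max _ (min _ _) = _
    rw [min_eq_left (by linarith), max_eq_right (by norm_num)]
  · obtain ⟨hk₀, hk₁⟩ := hrise hkx
    obtain ⟨hl₀, hl₁⟩ := hrise hlx
    have hkl : idx k < idx l + 1 := by exact_mod_cast (by linarith : (idx k : ℝ) < idx l + 1)
    have hlk : idx l < idx k + 1 := by exact_mod_cast (by linarith : (idx l : ℝ) < idx k + 1)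
    exact (List.idxOf_inj (Finset.mem_toList.2 hk)).1 (by omega : idx k = idx l)

open Classical in
/-- One equation per coordinate whose simultaneous solutions, for a staircase `σ` over `G`, are
points of `foldedCore φ G` at which `h` vanishes. -/
noncomputable def coreSystem (h : C(Cube (Coord ι P), ℝ)) (G : Finset (ι →₀ P))
    (σ : (ι →₀ P) → ℝ → ℝ) : Coord ι P → Cube (Coord ι P) → ℝ
  | .free, w => h w
  | .fold q, w =>
    if ∀ x, |φ q x| ≤ 26 then 4 * (w (.fold q) : ℝ) ^ 3 - 3 * (w (.fold q) : ℝ) - φ q w else 0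
  | .strip q α, w => w (.strip q α) - σ α (φ q w)
  | .face q i, w =>
    ∑ α ∈ G with SignCompatible φ q α, (4 - (w (.strip q α) : ℝ) ^ 2) * φ (α i) w

variable {φ} {h : C(Cube (Coord ι P), ℝ)} {G : Finset (ι →₀ P)} {σ : (ι →₀ P) → ℝ → ℝ}

lemma continuous_coreSystem (hσ : ∀ α, Continuous (σ α)) (j : Coord ι P) :
    Continuous (coreSystem φ h G σ j) := by
  change Continuous fun w => coreSystem φ h G σ j w
  cases j with
  | free => exact h.continuous
  | fold q =>
    simp only [coreSystem]
    split_ifs <;> fun_prop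
  | strip q α =>
    have := hσ α
    simp only [coreSystem]
    fun_prop
  | face q i =>
    simp only [coreSystem]
    fun_prop

lemma four_sub_sq_nonneg (t : Icc (-2 : ℝ) 2) : 0 ≤ 4 - (t : ℝ) ^ 2 := by
  nlinarith [t.2.1, t.2.2]

lemma coreSystem_nonpos (hσ : ∀ α x, σ α x ∈ Icc (-2) 2)
    (hh : ∀ w : Cube (Coord ι P), (w .free : ℝ) = -2 → h w ≤ 0) (j : Coord ι P)
    {w : Cube (Coord ι P)} (hw : (w j : ℝ) = -2) : coreSystem φ h G σ j w ≤ 0 := by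
  classical
  cases j with
  | free => exact hh w hw
  | fold q =>
    simp only [coreSystem]
    split_ifs with hq
    · rw [hw]
      linarith [(abs_le.1 (hq w)).1]
    · rfl
  | strip q α =>
    rw [coreSystem, hw]
    linarith [(hσ α (φ q w)).1]
  | face q i =>
    refine Finset.sum_nonpos fun α hα => mul_nonpos_of_nonneg_of_nonpos (four_sub_sq_nonneg _) ?_
    exact ((Finset.mem_filter.1 hα).2 i w).1 hw

lemma coreSystem_nonneg (hσ : ∀ α x, σ α x ∈ Icc (-2) 2)
    (hh : ∀ w : Cube (Coord ι P), (w .free : ℝ) = 2 → 0 ≤ h w) (j : Coord ι P)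
    {w : Cube (Coord ι P)} (hw : (w j : ℝ) = 2) : 0 ≤ coreSystem φ h G σ j w := by
  classical
  cases j with
  | free => exact hh w hw
  | fold q =>
    simp only [coreSystem]
    split_ifs with hq
    · rw [hw]
      linarith [(abs_le.1 (hq w)).2]
    · rfl
  | strip q α =>
    rw [coreSystem, hw]
    linarith [(hσ α (φ q w)).2]
  | face q i =>
    refine Finset.sum_nonneg fun α hα => mul_nonneg (four_sub_sq_nonneg _) ?_
    exact ((Finset.mem_filter.1 hα).2 i w).2 hw

-- In the strip of `α` the other strip coordinates are `±2`, so the equations of the face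
-- coordinates reduce to the vanishing of the `α i`.
lemma mem_foldedCore_of_coreSystem_eq_zero (hσ : ∀ α x, σ α x ∈ Icc (-2) 2)
    (hσ₀ : ∀ α, ∀ x ≤ 0, σ α x = -2) (hσ₁ : ∀ α ∈ G, ∀ x, 1 ≤ x → σ α x = 2)
    (hσ₂ : ∀ α ∈ G, ∀ β x, |σ α x| < 2 → |σ β x| < 2 → α = β)
    {w : Cube (Coord ι P)} (hw : ∀ j, coreSystem φ h G σ j w = 0) : w ∈ foldedCore φ G := by
  classical
  refine ⟨fun q hq => ?_, fun q α hα hcompat => ?_⟩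
  · have hfold := hw (.fold q)
    rw [coreSystem, if_pos hq] at hfold
    exact sub_eq_zero.1 hfold
  have hstrip (β : ι →₀ P) : (w (.strip q β) : ℝ) = σ β (φ q w) := sub_eq_zero.1 (hw (.strip q β))
  refine ⟨fun hlt => ?_, fun hlt => ?_, fun hlt i => ?_⟩
  · rw [hstrip, hσ₀ α _ (by linarith)]
  · rw [hstrip, hσ₁ α hα _ hlt.le]
  have hother (β : ι →₀ P) (hβα : β ≠ α) : 4 - (w (.strip q β) : ℝ) ^ 2 = 0 := by
    rw [hstrip] at hlt ⊢
    have hge : 2 ≤ |σ β (φ q w)| := not_lt.1 fun hβlt => hβα (hσ₂ α hα β _ hlt hβlt).symm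
    have hle : |σ β (φ q w)| ≤ 2 := abs_le.2 (hσ β (φ q w))
    rw [← sq_abs, hle.antisymm hge]
    norm_num
  have hface := hw (.face q i)
  rw [coreSystem, Finset.sum_eq_single_of_mem α (Finset.mem_filter.2 ⟨hα, hcompat⟩)
    fun β _ hβα => by rw [hother β hβα, zero_mul]] at hface
  refine (mul_eq_zero.1 hface).resolve_left ?_
  have hsq := sq_lt_sq' (abs_lt.1 hlt).1 (abs_lt.1 hlt).2
  linarith

lemma exists_mem_foldedCore_eq_zero_of_finset (φ : P → C(Cube (Coord ι P), ℝ))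
    (G : Finset (ι →₀ P))
    (h₀ : ∀ w : Cube (Coord ι P), (w .free : ℝ) = -2 → h w ≤ 0)
    (h₁ : ∀ w : Cube (Coord ι P), (w .free : ℝ) = 2 → 0 ≤ h w) :
    ∃ w ∈ foldedCore φ G, h w = 0 := by
  obtain ⟨σ, hσc, hσ, hσ₀, hσ₁, hσ₂⟩ := exists_staircase G
  obtain ⟨w, hw⟩ := poincareMiranda (by norm_num) (h := coreSystem φ h G σ)
    (continuous_coreSystem hσc) (fun j _ => coreSystem_nonpos hσ h₀ j)
    (fun j _ => coreSystem_nonneg hσ h₁ j)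
  exact ⟨w, mem_foldedCore_of_coreSystem_eq_zero hσ hσ₀ hσ₁ hσ₂ hw, hw .free⟩

lemma exists_mem_foldedCore_eq_zero (φ : P → C(Cube (Coord ι P), ℝ))
    (h₀ : ∀ w : Cube (Coord ι P), (w .free : ℝ) = -2 → h w ≤ 0)
    (h₁ : ∀ w : Cube (Coord ι P), (w .free : ℝ) = 2 → 0 ≤ h w) :
    ∃ w ∈ foldedCore φ univ, h w = 0 := by
  let Z (G : Finset (ι →₀ P)) : Set (Cube (Coord ι P)) := foldedCore φ G ∩ {w | h w = 0}
  have hZ (G) : IsClosed (Z G) :=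
    (isClosed_foldedCore φ _).inter (isClosed_eq h.continuous continuous_const)
  have hanti : Antitone Z := fun G G' hGG' =>
    inter_subset_inter_left _ (foldedCore_anti φ (Finset.coe_subset.2 hGG'))
  obtain ⟨w, hw⟩ := IsCompact.nonempty_iInter_of_directed_nonempty_isCompact_isClosed Z
    hanti.directed_ge (exists_mem_foldedCore_eq_zero_of_finset φ · h₀ h₁)
    (fun G => (hZ G).isCompact) hZ
  rw [← iInter_inter, ← foldedCore_univ] at hw
  exact ⟨w, hw⟩

theorem exists_isSubcontinuum_subset_foldedCore (φ : P → C(Cube (Coord ι P), ℝ)) :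
    ∃ M ⊆ foldedCore φ univ, IsSubcontinuum M ∧ M.Nontrivial := by
  have hface (c : ℝ) : IsClosed {w : Cube (Coord ι P) | (w .free : ℝ) = c} :=
    isClosed_eq (by fun_prop) continuous_const
  obtain ⟨M, hM, hcont, ⟨a, haM, ha⟩, ⟨b, hbM, hb⟩⟩ :=
    exists_isSubcontinuum_of_forall_exists_eq_zero (isClosed_foldedCore φ univ)
      (hface (-2)) (hface 2)
      (disjoint_left.2 fun w (ha : (w .free : ℝ) = -2) (hb : (w .free : ℝ) = 2) => by linarith)
      fun h h₀ h₁ => exists_mem_foldedCore_eq_zero φ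
        (fun w hw => (h₀ w hw).trans_le (by norm_num))
        fun w hw => zero_le_one.trans_eq (h₁ w hw).symm
  refine ⟨M, hM, hcont, a, haM, b, hbM, ?_⟩
  rintro rfl
  change (a .free : ℝ) = -2 at ha
  change (a .free : ℝ) = 2 at hb
  linarith

theorem hereditarilyIndecomposable_of_forall_mem_foldedCore {φ : P → C(Cube (Coord ι P), ℝ)}
    (hφ : DenseRange φ) {G : Set (ι →₀ P)} {Y : Type u} [TopologicalSpace Y]
    {f : Y → Cube (Coord ι P)} (hf : Topology.IsClosedEmbedding f)
    (hmem : ∀ y, f y ∈ foldedCore φ G) : HereditarilyIndecomposable Y := by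
  have := hf.t4Space
  refine hereditarilyIndecomposable_of_forall_exists_cubic_lift fun g hg => ?_
  obtain ⟨g', hg', hg'f⟩ := g.exists_extension_forall_mem_of_isClosedEmbedding
    (t := Icc (-2) 2) (fun y => abs_le.1 (hg y)) ⟨0, by norm_num⟩ hf
  obtain ⟨q, hq⟩ := hφ.exists_dist_lt g' one_pos
  have hdist (x : Cube (Coord ι P)) : |g' x - φ q x| < 1 :=
    (ContinuousMap.dist_apply_le_dist x).trans_lt hq
  have hbound (x : Cube (Coord ι P)) : |φ q x| ≤ 26 := by
    obtain ⟨h₁, h₂⟩ := abs_lt.1 (hdist x)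
    exact abs_le.2 ⟨by linarith [(hg' x).1], by linarith [(hg' x).2]⟩
  refine ⟨⟨fun y => f y (.fold q), by have := hf.continuous; fun_prop⟩, fun y => ?_⟩
  rw [ContinuousMap.coe_mk, (hmem y).1 q hbound, ← hg'f, Function.comp_apply, abs_sub_comm]
  exact hdist (f y)

lemma exists_eq_zero_of_isStripAt {φ : P → C(Cube (Coord ι P), ℝ)} {Y : Type*}
    [TopologicalSpace Y] [PreconnectedSpace Y] {f : Y → Cube (Coord ι P)} (hf : Continuous f)
    {q : P} {α : ι →₀ P} (hstrip : ∀ y, IsStripAt φ (f y) q α) {a b : Y} (ha : φ q (f a) < -1)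
    (hb : 1 < φ q (f b)) : ∃ y, ∀ i, φ (α i) (f y) = 0 := by
  obtain ⟨y, hy⟩ := mem_range_of_exists_le_of_exists_ge
    (f := fun y => (f y (.strip q α) : ℝ)) (c := 0) (by fun_prop)
    ⟨a, by rw [(hstrip a).eq_neg_two ha]; norm_num⟩ ⟨b, by rw [(hstrip b).eq_two hb]; norm_num⟩
  exact ⟨y, (hstrip y).eq_zero (by rw [show (f y (.strip q α) : ℝ) = 0 from hy]; norm_num)⟩

/-- The level set at `c` of the `i`-th coordinate of the cube attached to `q`; it is a face of that
cube for `c = -2` and `c = 2`. -/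
def faceSet (q : P) (i : ι) (c : ℝ) : Set (Cube (Coord ι P)) := {w | (w (.face q i) : ℝ) = c}

lemma isClosed_faceSet (q : P) (i : ι) (c : ℝ) : IsClosed (faceSet q i c) :=
  isClosed_eq (by fun_prop) continuous_const

lemma disjoint_faceSet (q : P) (i : ι) {c d : ℝ} (hcd : c ≠ d) :
    Disjoint (faceSet q i c) (faceSet q i d) :=
  disjoint_left.2 fun _ hc hd => hcd (hc.symm.trans hd)

lemma signCompatible_indicator {φ : P → C(Cube (Coord ι P), ℝ)} (hφ₀ : φ 0 = 0) {q : P}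
    {F : Finset ι} {p : F → P} (hneg : ∀ i : F, ∀ w ∈ faceSet q i.1 (-2), φ (p i) w < -1)
    (hpos : ∀ i : F, ∀ w ∈ faceSet q i.1 2, 1 < φ (p i) w) :
    SignCompatible φ q (Finsupp.indicator F fun i hi => p ⟨i, hi⟩) := by
  intro i w
  by_cases hi : i ∈ F
  · rw [Finsupp.indicator_of_mem hi]
    exact ⟨fun hw => by linarith [hneg ⟨i, hi⟩ w hw], fun hw => by linarith [hpos ⟨i, hi⟩ w hw]⟩
  · rw [Finsupp.indicator_of_notMem hi, hφ₀]
    exact ⟨fun _ => le_rfl, fun _ => le_rfl⟩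

lemma exists_forall_notMem_of_forall_mem_foldedCore {φ : P → C(Cube (Coord ι P), ℝ)}
    (hφ : DenseRange φ) (hφ₀ : φ 0 = 0) {Y : Type*} [TopologicalSpace Y] [PreconnectedSpace Y]
    {f : Y → Cube (Coord ι P)} (hf : Topology.IsClosedEmbedding f)
    (hmem : ∀ y, f y ∈ foldedCore φ Set.univ) {q : P} {a b : Y} (ha : φ q (f a) < -1)
    (hb : 1 < φ q (f b)) {F : Finset ι} {C D : F → Set Y} (hC : ∀ i, IsClosed (C i))
    (hD : ∀ i, IsClosed (D i)) (hfaceC : ∀ i, f ⁻¹' faceSet q i.1 (-2) ⊆ C i)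
    (hfaceD : ∀ i, f ⁻¹' faceSet q i.1 2 ⊆ D i) (hCD : ∀ i, Disjoint (C i) (D i)) :
    ∃ y, ∀ i, y ∉ C i ∧ y ∉ D i := by
  have hdisj (i : F) : Disjoint (f '' C i ∪ faceSet q i.1 (-2)) (f '' D i ∪ faceSet q i.1 2) := by
    rw [disjoint_left]
    rintro w (⟨y, hyC, rfl⟩ | hw) (⟨z, hzD, hzy⟩ | hw')
    · exact disjoint_left.1 (hCD i) hyC (hf.injective hzy ▸ hzD)
    · exact disjoint_left.1 (hCD i) hyC (hfaceD i hw')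
    · exact disjoint_left.1 (hCD i) (hfaceC i (hzy.symm ▸ hw : f z ∈ faceSet q i.1 (-2))) hzD
    · exact disjoint_left.1 (disjoint_faceSet q i.1 (by norm_num)) hw hw'
  choose p hpC hpD using fun i : F => exists_lt_neg_one_and_one_lt_of_denseRange hφ
    ((hf.isClosedMap _ (hC i)).union (isClosed_faceSet q i.1 (-2)))
    ((hf.isClosedMap _ (hD i)).union (isClosed_faceSet q i.1 2)) (hdisj i)
  have hcompat := signCompatible_indicator hφ₀ (fun i w hw => hpC i w (Or.inr hw))
    fun i w hw => hpD i w (Or.inr hw)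
  obtain ⟨y, hy⟩ := exists_eq_zero_of_isStripAt hf.continuous
    (fun y => (hmem y).2 q _ trivial hcompat) ha hb
  have hpy (i : F) : φ (p i) (f y) = 0 := by
    simpa only [Finsupp.indicator_of_mem i.2] using hy i
  exact ⟨y, fun i => ⟨fun hyC => by linarith [hpy i, hpC i _ (Or.inl ⟨y, hyC, rfl⟩)],
    fun hyD => by linarith [hpy i, hpD i _ (Or.inl ⟨y, hyD, rfl⟩)]⟩⟩

theorem hasEssentialFamily_of_forall_mem_foldedCore {φ : P → C(Cube (Coord ι P), ℝ)}
    (hφ : DenseRange φ) (hφ₀ : φ 0 = 0) {Y : Type u} [TopologicalSpace Y] [PreconnectedSpace Y]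
    [Nontrivial Y] {f : Y → Cube (Coord ι P)} (hf : Topology.IsClosedEmbedding f)
    (hmem : ∀ y, f y ∈ foldedCore φ Set.univ) : HasEssentialFamily Y #ι := by
  have := hf.compactSpace
  have := hf.t4Space
  obtain ⟨a, b, hab⟩ := exists_pair_ne Y
  obtain ⟨q, hqa, hqb⟩ := exists_lt_neg_one_and_one_lt_of_denseRange hφ
    (isClosed_singleton (x := f a)) (isClosed_singleton (x := f b))
    (by simpa using hf.injective.ne hab)
  have hess : IsEssentialFamily (fun i => f ⁻¹' faceSet q i (-2)) fun i => f ⁻¹' faceSet q i 2 :=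
    isEssentialFamily_of_forall_finset (fun i => (isClosed_faceSet q i _).preimage hf.continuous)
      (fun i => (isClosed_faceSet q i _).preimage hf.continuous)
      (fun i => (disjoint_faceSet q i (by norm_num)).preimage f)
      fun F C D => exists_forall_notMem_of_forall_mem_foldedCore hφ hφ₀ hf hmem (hqa _ rfl)
        (hqb _ rfl)
  exact ⟨ι, _, _, rfl, hess.injective, hess⟩

end Core

section Cardinality

lemma mk_mvPolynomial_rat_le {S : Type u} (hS : ℵ₀ ≤ #S) : #(MvPolynomial S ℚ) ≤ #S :=
  MvPolynomial.cardinalMk_le_max_lift.trans (by simp [hS])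

lemma mk_coord_le {ι P : Type u} [Zero P] [Nontrivial P] (hι : ℵ₀ ≤ #ι) (hP : #P ≤ #ι) :
    #(Coord ι P) ≤ #ι := by
  have : Infinite ι := infinite_iff.2 hι
  let ofSum : Option (P ⊕ (P × (ι →₀ P)) ⊕ (P × ι)) → Coord ι P
    | none => .free
    | some (.inl q) => .fold q
    | some (.inr (.inl p)) => .strip p.1 p.2
    | some (.inr (.inr p)) => .face p.1 p.2
  have hsurj : Function.Surjective ofSum := by
    rintro (_ | q | ⟨q, α⟩ | ⟨q, i⟩)
    exacts [⟨none, rfl⟩, ⟨some (.inl q), rfl⟩, ⟨some (.inr (.inl (q, α))), rfl⟩,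
      ⟨some (.inr (.inr (q, i))), rfl⟩]
  have hfinsupp : #(ι →₀ P) ≤ #ι := by
    rw [mk_finsupp_of_infinite]
    exact max_le le_rfl hP
  refine (mk_le_of_surjective hsurj).trans ?_
  rw [mk_option, mk_sum, mk_sum, mk_prod, mk_prod]
  simp only [lift_id]
  exact add_le_of_le hι (add_le_of_le hι hP (add_le_of_le hι (mul_le_of_le hι hP hfinsupp)
    (mul_le_of_le hι hP le_rfl))) (one_le_aleph0.trans hι)

end Cardinality

section Existence

lemma exists_denseRange_aeval_cube {S : Type u} (hS : ℵ₀ ≤ #S) :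
    ∃ φ : MvPolynomial S ℚ → C(Cube (Coord S (MvPolynomial S ℚ)), ℝ), DenseRange φ ∧ φ 0 = 0 := by
  have hcard := mk_coord_le hS (mk_mvPolynomial_rat_le hS)
  have : Nonempty (Coord S (MvPolynomial S ℚ)) := ⟨.free⟩
  obtain ⟨e⟩ := hcard
  let coord (s : S) : C(Cube (Coord S (MvPolynomial S ℚ)), ℝ) :=
    ⟨fun w => w (Function.invFun e s), by fun_prop⟩
  refine ⟨MvPolynomial.aeval (R := ℚ) coord, denseRange_aeval_of_separatesPoints fun x y hxy => ?_,
    map_zero _⟩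
  obtain ⟨j, hj⟩ := Function.ne_iff.1 hxy
  exact ⟨e j, by simpa [coord, Function.leftInverse_invFun e.injective j, Subtype.val_inj] using hj⟩

theorem exists_hereditarilyIndecomposable_continuum {κ : Cardinal.{u}} (hκ : ℵ₀ ≤ κ) :
    ∃ (X : Type u) (_ : TopologicalSpace X),
      CompactSpace X ∧ T2Space X ∧ ConnectedSpace X ∧ Nontrivial X ∧
      HereditarilyIndecomposable X ∧ topWeight X = κ ∧
      ∀ C : Set X, IsSubcontinuum C → C.Nontrivial → HasEssentialFamily C κ := by
  obtain ⟨S, rfl⟩ : ∃ S : Type u, #S = κ := ⟨κ.out, mk_out κ⟩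
  obtain ⟨φ, hφ, hφ₀⟩ := exists_denseRange_aeval_cube hκ
  obtain ⟨M, hMsub, hM, hMn⟩ := exists_isSubcontinuum_subset_foldedCore φ
  have : CompactSpace M := isCompact_iff_compactSpace.1 hM.1
  have : ConnectedSpace M := isConnected_iff_connectedSpace.1 hM.2
  have : Nontrivial M := hMn.coe_sort
  have hemb : Topology.IsClosedEmbedding (Subtype.val : M → _) :=
    hM.1.isClosed.isClosedEmbedding_subtypeVal
  have hmem (x : M) : (x : Cube (Coord S (MvPolynomial S ℚ))) ∈ foldedCore φ Set.univ := hMsub x.2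
  refine ⟨M, inferInstance, inferInstance, inferInstance, inferInstance, inferInstance,
    hereditarilyIndecomposable_of_forall_mem_foldedCore hφ hemb hmem, le_antisymm ?_ ?_,
    fun C hC hCn => ?_⟩
  · exact (topWeight_le_of_isInducing hemb.isInducing).trans
      ((topWeight_le_of_denseRange hφ).trans (mk_mvPolynomial_rat_le hκ))
  · exact (hasEssentialFamily_of_forall_mem_foldedCore hφ hφ₀ hemb hmem).le_topWeight hκ
  · have : ConnectedSpace C := isConnected_iff_connectedSpace.1 hC.2
    have : Nontrivial C := hCn.coe_sort
    exact hasEssentialFamily_of_forall_mem_foldedCore hφ hφ₀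
      (hemb.comp hC.1.isClosed.isClosedEmbedding_subtypeVal) fun x => hmem x

end Existence

section Discrete

variable {X : Type u} [TopologicalSpace X] [DiscreteTopology X]

lemma IsSubcontinuum.subsingleton_of_discreteTopology {C : Set X} (hC : IsSubcontinuum C) :
    C.Subsingleton :=
  hC.2.isPreconnected.subsingleton

lemma hereditarilyIndecomposable_of_discreteTopology : HereditarilyIndecomposable X := by
  rintro C D hC - ⟨x, hxC, hxD⟩
  exact Or.inl fun y hy => hC.subsingleton_of_discreteTopology hy hxC ▸ hxD

end Discrete

theorem mainTheorem3 (κ : Cardinal.{u}) :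
    ∃ (X : Type u) (_ : TopologicalSpace X),
      CompactSpace X ∧ T2Space X ∧
      HereditarilyIndecomposable X ∧
      topWeight X = κ ∧
      (∀ C : Set X, IsSubcontinuum C → C.Nontrivial → HasEssentialFamily C κ) ∧
      (ℵ₀ ≤ κ → ConnectedSpace X ∧ Nontrivial X) := by
  rcases le_or_gt ℵ₀ κ with hκ | hκ
  · obtain ⟨X, hX, hcpt, hT2, hconn, hnontriv, hindec, hweight, hess⟩ :=
      exists_hereditarilyIndecomposable_continuum hκ
    exact ⟨X, hX, hcpt, hT2, hindec, hweight, hess, fun _ => ⟨hconn, hnontriv⟩⟩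
  · obtain ⟨X, rfl⟩ : ∃ X : Type u, #X = κ := ⟨κ.out, mk_out κ⟩
    have : Finite X := lt_aleph0_iff_finite.1 hκ
    let _ : TopologicalSpace X := ⊥
    have : DiscreteTopology X := ⟨rfl⟩
    exact ⟨X, ⊥, inferInstance, inferInstance, hereditarilyIndecomposable_of_discreteTopology,
      topWeight_eq_mk_of_discreteTopology X,
      fun C hC hn => absurd hC.subsingleton_of_discreteTopology hn.not_subsingleton,
      fun h => absurd h hκ.not_ge⟩
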